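/- An implicative bilattice is an algebra $\mathbf{B}=\langle B,\land,\lor,\otimes,\oplus,\supset,\neg\rangle$ such that (a) $\langle B,\land,\lor\rangle$ and $\langle B,\otimes,\oplus\rangle$ are lattices, with orders $\leq_t$ and $\leq_k$ respectively, and $\neg$ is an involution ($\neg\neg a=a$) that reverses $\leq_t$ and preserves $\leq_k$ (so $\langle B,\land,\lor,\otimes,\oplus,\neg\rangle$ is a bilattice); (b) $\mathbf{B}$ satisfies the equations $(x\supset x)\supset y\approx y$; $x\supset(y\supset z)\approx(x\land y)\supset z\approx(x\otimes y)\supset z$; $((x\supset y)\supset x)\supset x\approx x\supset x$; $(x\lor y)\supset z\approx(x\supset z)\land(y\supset z)\approx(x\oplus y)\supset z$; $x\land((x\supset y)\supset(x\otimes y))\approx x$; $\neg(x\supset y)\supset z\approx(x\land\neg y)\supset z$. Let $\mathsf{ImpBiLat}$ be the class of implicative bilattices. Let $\mathcal{FOUR}_\supset$ be the algebra on $\{\mathsf f,\bot,\top,\mathsf t\}$ in which $\leq_t$ is the lattice order with minimum $\mathsf f$, maximum $\mathsf t$ and $\bot,\top$ incomparable; $\leq_k$ is the lattice order with minimum $\bot$,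 maximum $\top$ and $\mathsf f,\mathsf t$ incomparable; $\neg$ exchanges $\mathsf f$ and $\mathsf t$ and fixes $\bot$ and $\top$; and $a\supset b=\mathsf t$ if $a\in\{\mathsf f,\bot\}$, $a\supset b=b$ if $a\in\{\top,\mathsf t\}$. For an algebra $\mathbf A$, let $V(\mathbf A)$ be the variety generated by $\mathbf A$, i.e. the least class of algebras of the same type that contains $\mathbf A$ and is closed under homomorphic images, subalgebras and direct products. Let $\mathcal{LB}_\supset$ be the logic, on the formulas built from countably many variables with $\land,\lor,\otimes,\oplus,\supset,\neg$, in which $\varphi$ follows from a set of formulas $\Gamma$ iff $h[\Gamma]\subseteq F$ implies $h(\varphi)\in F$ for every homomorphism $h$ from the formula algebra into $\mathbf B$, for all pairs $\langle\mathbf B,F\rangle$ of the following kind: the $\supset$-free reduct of $\mathbf B$ is a bilattice with a $\leq_t$-maximum $\mathsf t$; $F$ is a prime bifilter, that is, $\emptyset\ne F\ne B$ and, for all $a,b\in B$, $a\land b\in F$ iff $a\otimes b\in F$ iff both $a,b\in F$, and $a\lor b\in F$ iff $a\oplus b\in F$ iff $a\in F$ or $b\in F$; and $a\supset b=\mathsf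 t$ if $a\notin F$, $a\supset b=b$ if $a\in F$. Let $\mathbf{Alg^*}\mathcal{LB}_\supset$ be the class of the algebras $\mathbf A$ for which there is a set $D\subseteq A$ such that $\langle\mathbf A,D\rangle$ is a model of $\mathcal{LB}_\supset$ (for every homomorphism $h$ from the formula algebra into $\mathbf A$, if $\varphi$ follows from $\Gamma$ in $\mathcal{LB}_\supset$ and $h[\Gamma]\subseteq D$, then $h(\varphi)\in D$) and is reduced (the greatest congruence $\theta$ of $\mathbf A$ such that $a\in D$ and $a\mathrel\theta b$ imply $b\in D$ is the identity). Theorem. $\mathcal{FOUR}_\supset$ is a four-element implicative bilattice, and $\mathsf{ImpBiLat}$ is the variety generated by it: $\mathsf{ImpBiLat}=V(\mathcal{FOUR}_\supset)$. Moreover, a non-trivial implicative bilattice is subdirectly irreducible if and only if it is isomorphic to $\mathcal{FOUR}_\supset$. Consequently $\mathbf{Alg^*}\mathcal{LB}_\supset=V(\mathcal{FOUR}_\supset)$. -/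

import Mathlib

universe u v

namespace Bilat

/-! ### Similarity types, products, homomorphisms -/

/-- The algebraic language `{∧, ∨, ⊗, ⊕, ¬}` of bilattices. -/
class BilatticeSig (A : Type u) where
  tMeet : A → A → A
  tJoin : A → A → A
  kMeet : A → A → A
  kJoin : A → A → A
  neg : A → A

/-- The algebraic language `{∧, ∨, ⊗, ⊕, ⊃, ¬}` of implicative bilattices. -/
class ImpSig (A : Type u) extends BilatticeSig A where
  imp : A → A → A

infixl:70 " ⊓ₜ " => BilatticeSig.tMeet
infixl:70 " ⊔ₜ " => BilatticeSig.tJoin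
infixl:70 " ⊓ₖ " => BilatticeSig.kMeet
infixl:70 " ⊔ₖ " => BilatticeSig.kJoin
infixr:65 " ⊃ᵢ " => ImpSig.imp
prefix:max "∼ₙ" => BilatticeSig.neg

/-- The direct product of a family of algebras, with pointwise operations. -/
instance piImpSig {I : Type u} (C : I → Type v) [∀ i, ImpSig (C i)] :
    ImpSig (∀ i, C i) where
  tMeet a b := fun i => a i ⊓ₜ b i
  tJoin a b := fun i => a i ⊔ₜ b i
  kMeet a b := fun i => a i ⊓ₖ b i
  kJoin a b := fun i => a i ⊔ₖ b i
  neg a := fun i => ∼ₙ(a i)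
  imp a b := fun i => a i ⊃ᵢ b i

/-- Homomorphisms of algebras of the type `{∧, ∨, ⊗, ⊕, ⊃, ¬}`. -/
structure IsHom {A : Type u} {B : Type v} [ImpSig A] [ImpSig B] (f : A → B) : Prop where
  map_tMeet : ∀ a b, f (a ⊓ₜ b) = f a ⊓ₜ f b
  map_tJoin : ∀ a b, f (a ⊔ₜ b) = f a ⊔ₜ f b
  map_kMeet : ∀ a b, f (a ⊓ₖ b) = f a ⊓ₖ f b
  map_kJoin : ∀ a b, f (a ⊔ₖ b) = f a ⊔ₖ f b
  map_neg : ∀ a, f (∼ₙa) = ∼ₙ(f a)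
  map_imp : ∀ a b, f (a ⊃ᵢ b) = f a ⊃ᵢ f b

/-- Two algebras are isomorphic. -/
def Isomorphic (A : Type u) (B : Type v) [ImpSig A] [ImpSig B] : Prop :=
  ∃ f : A → B, IsHom f ∧ Function.Bijective f

/-- `θ` is a congruence of the algebra `A`. -/
structure IsCongruence {A : Type u} [ImpSig A] (θ : Setoid A) : Prop where
  tMeet : ∀ {a b c d}, θ a b → θ c d → θ (a ⊓ₜ c) (b ⊓ₜ d)
  tJoin : ∀ {a b c d}, θ a b → θ c d → θ (a ⊔ₜ c) (b ⊔ₜ d)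
  kMeet : ∀ {a b c d}, θ a b → θ c d → θ (a ⊓ₖ c) (b ⊓ₖ d)
  kJoin : ∀ {a b c d}, θ a b → θ c d → θ (a ⊔ₖ c) (b ⊔ₖ d)
  neg : ∀ {a b}, θ a b → θ (∼ₙa) (∼ₙb)
  imp : ∀ {a b c d}, θ a b → θ c d → θ (a ⊃ᵢ c) (b ⊃ᵢ d)

/-- An algebra of the type `{∧, ∨, ⊗, ⊕, ⊃, ¬}`: a non-empty set with these operations. -/
structure ImpAlg : Type (u + 1) where
  carrier : Type u
  [nonempty : Nonempty carrier]
  [sig : ImpSig carrier]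

instance : CoeSort ImpAlg.{u} (Type u) := ⟨ImpAlg.carrier⟩

attribute [instance] ImpAlg.nonempty ImpAlg.sig

/-! ### Bilattices and implicative bilattices -/

/-- The identities of a lattice with the given meet and join. -/
structure IsLattice {A : Type u} (meet join : A → A → A) : Prop where
  meet_comm : ∀ a b, meet a b = meet b a
  join_comm : ∀ a b, join a b = join b a
  meet_assoc : ∀ a b c, meet (meet a b) c = meet a (meet b c)
  join_assoc : ∀ a b c, join (join a b) c = join a (join b c)
  meet_join_self : ∀ a b, meet a (join a b) = a
  join_meet_self : ∀ a b, join a (meet a b) = a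

/-- The truth order. -/
def tLe {A : Type u} [BilatticeSig A] (a b : A) : Prop := a ⊓ₜ b = a

/-- The knowledge order. -/
def kLe {A : Type u} [BilatticeSig A] (a b : A) : Prop := a ⊓ₖ b = a

/-- Bilattices (neither boundedness nor any interlacing is required). -/
structure IsBilattice (A : Type u) [BilatticeSig A] : Prop where
  tLattice : IsLattice (A := A) BilatticeSig.tMeet BilatticeSig.tJoin
  kLattice : IsLattice (A := A) BilatticeSig.kMeet BilatticeSig.kJoin
  neg_tLe : ∀ a b : A, tLe a b → tLe (∼ₙb) (∼ₙa)
  neg_kLe : ∀ a b : A, kLe a b → kLe (∼ₙa) (∼ₙb)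
  neg_neg : ∀ a : A, ∼ₙ(∼ₙa) = a

/-- Implicative bilattices. -/
structure IsImplicativeBilattice (A : Type u) [ImpSig A] : Prop where
  bilattice : IsBilattice A
  ib1 : ∀ x y : A, (x ⊃ᵢ x) ⊃ᵢ y = y
  ib2_t : ∀ x y z : A, x ⊃ᵢ (y ⊃ᵢ z) = (x ⊓ₜ y) ⊃ᵢ z
  ib2_k : ∀ x y z : A, (x ⊓ₜ y) ⊃ᵢ z = (x ⊓ₖ y) ⊃ᵢ z
  ib3 : ∀ x y : A, ((x ⊃ᵢ y) ⊃ᵢ x) ⊃ᵢ x = x ⊃ᵢ x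
  ib4_t : ∀ x y z : A, (x ⊔ₜ y) ⊃ᵢ z = (x ⊃ᵢ z) ⊓ₜ (y ⊃ᵢ z)
  ib4_k : ∀ x y z : A, (x ⊃ᵢ z) ⊓ₜ (y ⊃ᵢ z) = (x ⊔ₖ y) ⊃ᵢ z
  ib5 : ∀ x y : A, x ⊓ₜ ((x ⊃ᵢ y) ⊃ᵢ (x ⊓ₖ y)) = x
  ib6 : ∀ x y z : A, ∼ₙ(x ⊃ᵢ y) ⊃ᵢ z = (x ⊓ₜ ∼ₙy) ⊃ᵢ z

/-- The class of implicative bilattices. -/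
def ImpBiLat : Set ImpAlg.{u} := {A | IsImplicativeBilattice A}

/-! ### The four-element implicative bilattice -/

/-- The four truth values: `f` (only false), `bot` (neither), `top` (both), `t` (only true). -/
inductive Four : Type u
  | f | bot | top | t

namespace Four

/-- Meet in the truth order `f < bot, top < t`. -/
def tMeet : Four.{u} → Four.{u} → Four.{u}
  | t, x => x
  | x, t => x
  | bot, bot => bot
  | top, top => top
  | _, _ => f

/-- Join in the truth order `f < bot, top < t`. -/
def tJoin : Four.{u} → Four.{u} → Four.{u}
  | f, x => x
  | x, f => x
  | bot, bot => bot
  | top, top => top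
  | _, _ => t

/-- Meet in the knowledge order `bot < f, t < top`. -/
def kMeet : Four.{u} → Four.{u} → Four.{u}
  | top, x => x
  | x, top => x
  | f, f => f
  | t, t => t
  | _, _ => bot

/-- Join in the knowledge order `bot < f, t < top`. -/
def kJoin : Four.{u} → Four.{u} → Four.{u}
  | bot, x => x
  | x, bot => x
  | f, f => f
  | t, t => t
  | _, _ => top

/-- Negation exchanges `f` and `t` and fixes `bot` and `top`. -/
def neg : Four.{u} → Four.{u}
  | f => t
  | t => f
  | bot => bot
  | top => top

/-- The implication: `a ⊃ b = t` if `a` is not in `{t, top}`, and `a ⊃ b = b` otherwise. -/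
def imp : Four.{u} → Four.{u} → Four.{u}
  | f, _ => t
  | bot, _ => t
  | top, b => b
  | t, b => b

instance : ImpSig Four.{u} where
  tMeet := tMeet
  tJoin := tJoin
  kMeet := kMeet
  kJoin := kJoin
  neg := neg
  imp := imp

instance : Nonempty Four.{u} := ⟨top⟩

end Four

/-- The algebra `FOUR⊃`. -/
def FOURimp : ImpAlg.{u} := ⟨Four.{u}⟩

/-! ### Varieties and subdirect irreducibility -/

/-- A variety: a class of algebras closed under homomorphic images, (isomorphic copies of)
subalgebras and direct products. -/
structure IsVariety (K : Set ImpAlg.{u}) : Prop where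
  image : ∀ (A B : ImpAlg.{u}) (h : A → B), A ∈ K → IsHom h → Function.Surjective h → B ∈ K
  sub : ∀ (A B : ImpAlg.{u}) (h : B → A), A ∈ K → IsHom h → Function.Injective h → B ∈ K
  prod : ∀ (I : Type u) (C : I → ImpAlg.{u}), (∀ i, C i ∈ K) → (⟨∀ i, C i⟩ : ImpAlg.{u}) ∈ K

/-- `V(K)`: the least variety containing the class `K`. -/
def varietyGen (K : Set ImpAlg.{u}) : Set ImpAlg.{u} :=
  ⋂₀ {V | IsVariety V ∧ K ⊆ V}

/-- An algebra is subdirectly irreducible if, for each of its subdirect embeddings into a direct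
product, one of the projections restricts to an isomorphism. -/
def SubdirectlyIrreducible (A : ImpAlg.{u}) : Prop :=
  ∀ (I : Type u) [Nonempty I] (C : I → ImpAlg.{u}) (α : A → ∀ i, C i),
    IsHom α → Function.Injective α → (∀ i, Function.Surjective fun a => α a i) →
      ∃ i, Function.Bijective fun a => α a i

/-! ### Formulas, logics and reduced matrices -/

/-- Formulas in the language `{∧, ∨, ⊗, ⊕, ⊃, ¬}` over countably many variables. -/
inductive Fm : Type
  | var : ℕ → Fm
  | tMeet : Fm → Fm → Fm
  | tJoin : Fm → Fm → Fm
  | kMeet : Fm → Fm → Fm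
  | kJoin : Fm → Fm → Fm
  | imp : Fm → Fm → Fm
  | neg : Fm → Fm

/-- The algebra of formulas. -/
instance : ImpSig Fm where
  tMeet := Fm.tMeet
  tJoin := Fm.tJoin
  kMeet := Fm.kMeet
  kJoin := Fm.kJoin
  neg := Fm.neg
  imp := Fm.imp

/-- The consequence relation defined by the matrix `⟨A, D⟩`. -/
def MatrixEntails {A : Type u} [ImpSig A] (D : Set A) (Γ : Set Fm) (φ : Fm) : Prop :=
  ∀ h : Fm → A, IsHom h → (∀ γ ∈ Γ, h γ ∈ D) → h φ ∈ D

/-- `⟨A, D⟩` is a model of the logic with consequence relation `L`. -/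
def IsModel (L : Set Fm → Fm → Prop) {A : Type u} [ImpSig A] (D : Set A) : Prop :=
  ∀ (Γ : Set Fm) (φ : Fm), L Γ φ → MatrixEntails D Γ φ

/-- The matrix congruences of `⟨A, D⟩`: the congruences of `A` that are compatible with `D`. -/
def matrixCongruences {A : Type u} [ImpSig A] (D : Set A) : Set (Setoid A) :=
  {θ | IsCongruence θ ∧ ∀ a b, a ∈ D → θ a b → b ∈ D}

/-- `θ` is the Leibniz congruence of `⟨A, D⟩`, i.e. its greatest matrix congruence. -/
def IsLeibnizCongruence {A : Type u} [ImpSig A] (D : Set A) (θ : Setoid A) : Prop :=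
  IsGreatest (matrixCongruences D) θ

/-- A matrix is reduced if its Leibniz congruence is the identity relation. -/
def IsReduced {A : Type u} [ImpSig A] (D : Set A) : Prop :=
  IsLeibnizCongruence D ⊥

/-- `Alg* L`: the class of algebraic reducts of the reduced matrix models of `L`. -/
def AlgStar (L : Set Fm → Fm → Prop) : Set ImpAlg.{u} :=
  {A | ∃ D : Set A, IsModel L D ∧ IsReduced D}

/-! ### The logic of logical bilattices with implication -/

/-- Prime bifilters of a bilattice; in particular they are non-empty and proper. -/
structure IsPrimeBifilter {B : Type u} [BilatticeSig B] (F : Set B) : Prop where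
  nonempty : F.Nonempty
  proper : F ≠ Set.univ
  tMeet_mem : ∀ a b, a ⊓ₜ b ∈ F ↔ a ∈ F ∧ b ∈ F
  kMeet_mem : ∀ a b, a ⊓ₖ b ∈ F ↔ a ∈ F ∧ b ∈ F
  tJoin_mem : ∀ a b, a ⊔ₜ b ∈ F ↔ a ∈ F ∨ b ∈ F
  kJoin_mem : ∀ a b, a ⊔ₖ b ∈ F ↔ a ∈ F ∨ b ∈ F

/-- `⟨B, F⟩` is a logical bilattice whose truth order has a maximum `t`, enriched with the
operation `⊃` given by `a ⊃ b = t` if `a ∉ F` and `a ⊃ b = b` if `a ∈ F`. -/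
structure IsLogicalBilatticeImp (B : Type u) [ImpSig B] (F : Set B) : Prop where
  bilattice : IsBilattice B
  prime : IsPrimeBifilter F
  imp_eq : ∃ t : B, (∀ a, tLe a t) ∧
    ∀ a b : B, (a ∉ F → a ⊃ᵢ b = t) ∧ (a ∈ F → a ⊃ᵢ b = b)

/-- The consequence relation of the logic `LB⊃`: preservation of the designated elements in all
logical bilattices (on types of the universe `v`) enriched with implication. -/
def LBimp (Γ : Set Fm) (φ : Fm) : Prop :=
  ∀ (B : Type v) [ImpSig B] (F : Set B), IsLogicalBilatticeImp B F → MatrixEntails F Γ φ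

end Bilat

namespace Bilat

/-! ### Lattices and bilattices -/

namespace IsLattice

variable {A : Type u} {m j : A → A → A}

/-! A value of `FOUR⊃` is determined by two bits: whether it is designated (`top` or `t`) and
whether its negation is. Hence a homomorphism from a bilattice with implication to `FOUR⊃` amounts
to a set `P` that treats the operations as designation does (`IsFourPrime`).

The core is that such homomorphisms separate the points of an implicative bilattice
(`exists_hom_ne`). The elements `d` with `d ⊃ y = y` for all `y` play the role of theorems, and
implication obeys classical rules: exchange, a deduction theorem and Peirce's law. If `a ⊃ b` is not
a theorem, Zorn's lemma gives a deductive filter that contains `a` and is maximal among those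
omitting `b`; such a filter is four-prime. If every homomorphism identifies `a` and `b`, the
implications between them and between their negations are all theorems, and `ib5` forces `a = a ⊗ b
= b`.

Thus every implicative bilattice embeds in a power of `FOUR⊃`, which gives the generation of the
variety. The subdirectly irreducible members follow because `FOUR⊃` is simple and its only proper
subalgebra is trivial. For the logic, a prime bifilter is four-prime, so `LB⊃` is the logic of the
single matrix on `FOUR⊃`. There `biimp x y` is designated exactly when `x = y`; in any model it
therefore defines a matrix congruence, and reduced models inherit the identities of `FOUR⊃`. -/

theorem meet_idem (h : IsLattice m j) (a : A) : m a a = a := by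
  have := h.meet_join_self a (m a a)
  rwa [h.join_meet_self] at this

theorem swap (h : IsLattice m j) : IsLattice j m :=
  ⟨h.join_comm, h.meet_comm, h.join_assoc, h.meet_assoc, h.join_meet_self, h.meet_join_self⟩

theorem join_eq_iff (h : IsLattice m j) (a b : A) : j a b = a ↔ m b a = b := by
  constructor
  · intro e
    rw [← e, h.join_comm, h.meet_join_self]
  · intro e
    rw [← e, h.meet_comm, h.join_meet_self]

theorem antisymm (h : IsLattice m j) {a b : A} (h₁ : m a b = a) (h₂ : m b a = b) : a = b := by
  rw [← h₁, h.meet_comm, h₂]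

theorem meet_le_left (h : IsLattice m j) (a b : A) : m (m a b) a = m a b := by
  rw [h.meet_comm, ← h.meet_assoc, h.meet_idem]

theorem meet_le_right (h : IsLattice m j) (a b : A) : m (m a b) b = m a b := by
  rw [h.meet_assoc, h.meet_idem]

theorem le_meet (h : IsLattice m j) {a b c : A} (h₁ : m c a = c) (h₂ : m c b = c) :
    m c (m a b) = c := by
  rw [← h.meet_assoc, h₁, h₂]

theorem le_join_left (h : IsLattice m j) (a b : A) : m a (j a b) = a := h.meet_join_self a b

theorem le_join_right (h : IsLattice m j) (a b : A) : m b (j a b) = b := by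
  rw [h.join_comm, h.meet_join_self]

/-- An order-reversing involution is a dual automorphism: it turns the greatest lower bound into the
least upper bound. -/
theorem antitone_meet (h : IsLattice m j) {n : A → A} (hn : ∀ a, n (n a) = a)
    (anti : ∀ a b, m a b = a → m (n b) (n a) = n b) (a b : A) : n (m a b) = j (n a) (n b) := by
  have ha := anti _ _ (h.le_join_left (n a) (n b))
  have hb := anti _ _ (h.le_join_right (n a) (n b))
  rw [hn] at ha hb
  have h₁ := anti _ _ (h.le_meet ha hb)
  rw [hn] at h₁
  refine h.antisymm h₁ ?_
  have hs := h.swap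
  rw [← h.join_eq_iff]
  have ha' := (h.join_eq_iff _ _).2 (anti _ _ (h.meet_le_left a b))
  have hb' := (h.join_eq_iff _ _).2 (anti _ _ (h.meet_le_right a b))
  exact hs.le_meet ha' hb'

theorem monotone_meet (h : IsLattice m j) {n : A → A} (hn : ∀ a, n (n a) = a)
    (mono : ∀ a b, m a b = a → m (n a) (n b) = n a) (a b : A) : n (m a b) = m (n a) (n b) := by
  refine h.antisymm (h.le_meet (mono _ _ (h.meet_le_left a b)) (mono _ _ (h.meet_le_right a b))) ?_
  have ha := mono _ _ (h.meet_le_left (n a) (n b))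
  have hb := mono _ _ (h.meet_le_right (n a) (n b))
  rw [hn] at ha hb
  have h₁ := mono _ _ (h.le_meet ha hb)
  rwa [hn] at h₁

end IsLattice

namespace IsBilattice

variable {A : Type u} [BilatticeSig A]

theorem neg_tMeet (h : IsBilattice A) (a b : A) : ∼ₙ(a ⊓ₜ b) = ∼ₙa ⊔ₜ ∼ₙb :=
  h.tLattice.antitone_meet h.neg_neg h.neg_tLe a b

theorem neg_tJoin (h : IsBilattice A) (a b : A) : ∼ₙ(a ⊔ₜ b) = ∼ₙa ⊓ₜ ∼ₙb := by
  rw [← h.neg_neg (∼ₙa ⊓ₜ ∼ₙb), h.neg_tMeet, h.neg_neg, h.neg_neg]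

theorem neg_kMeet (h : IsBilattice A) (a b : A) : ∼ₙ(a ⊓ₖ b) = ∼ₙa ⊓ₖ ∼ₙb :=
  h.kLattice.monotone_meet h.neg_neg h.neg_kLe a b

theorem neg_kJoin (h : IsBilattice A) (a b : A) : ∼ₙ(a ⊔ₖ b) = ∼ₙa ⊔ₖ ∼ₙb :=
  h.kLattice.swap.monotone_meet h.neg_neg
    (fun _ _ e => (h.kLattice.join_eq_iff _ _).2
      (h.neg_kLe _ _ ((h.kLattice.join_eq_iff _ _).1 e))) a b

end IsBilattice

/-! ### Homomorphisms -/

theorem IsHom.comp {A : Type*} {B : Type*} {C : Type*} [ImpSig A] [ImpSig B] [ImpSig C]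
    {g : B → C} {f : A → B} (hg : IsHom g) (hf : IsHom f) : IsHom (fun a => g (f a)) where
  map_tMeet a b := by rw [hf.map_tMeet, hg.map_tMeet]
  map_tJoin a b := by rw [hf.map_tJoin, hg.map_tJoin]
  map_kMeet a b := by rw [hf.map_kMeet, hg.map_kMeet]
  map_kJoin a b := by rw [hf.map_kJoin, hg.map_kJoin]
  map_neg a := by rw [hf.map_neg, hg.map_neg]
  map_imp a b := by rw [hf.map_imp, hg.map_imp]

theorem IsHom.inverse {A : Type*} {B : Type*} [ImpSig A] [ImpSig B] {f : A → B} (hf : IsHom f)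
    {g : B → A} (hgf : ∀ a, g (f a) = a) (hfg : ∀ b, f (g b) = b) : IsHom g where
  map_tMeet a b := by rw [← hgf (g a ⊓ₜ g b), hf.map_tMeet, hfg, hfg]
  map_tJoin a b := by rw [← hgf (g a ⊔ₜ g b), hf.map_tJoin, hfg, hfg]
  map_kMeet a b := by rw [← hgf (g a ⊓ₖ g b), hf.map_kMeet, hfg, hfg]
  map_kJoin a b := by rw [← hgf (g a ⊔ₖ g b), hf.map_kJoin, hfg, hfg]
  map_neg a := by rw [← hgf (∼ₙ(g a)), hf.map_neg, hfg]
  map_imp a b := by rw [← hgf (g a ⊃ᵢ g b), hf.map_imp, hfg, hfg]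

/-! ### The algebra `FOUR⊃` -/

namespace Four

/-- The designated values `top` and `t`. -/
def Des : Four.{u} → Prop
  | f => False
  | bot => False
  | top => True
  | t => True

/-- The two-bit description of the truth values, which reduces equations in `FOUR⊃` to statements
about designation. -/
theorem ext_des {x y : Four.{u}} (h₁ : Des x ↔ Des y) (h₂ : Des (∼ₙx) ↔ Des (∼ₙy)) : x = y := by
  cases x <;> cases y <;> simp_all [Des, BilatticeSig.neg, neg]

theorem des_tMeet (x y : Four.{u}) : Des (x ⊓ₜ y) ↔ Des x ∧ Des y := by
  cases x <;> cases y <;> simp [Des, BilatticeSig.tMeet, tMeet]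

theorem des_kMeet (x y : Four.{u}) : Des (x ⊓ₖ y) ↔ Des x ∧ Des y := by
  cases x <;> cases y <;> simp [Des, BilatticeSig.kMeet, kMeet]

theorem des_tJoin (x y : Four.{u}) : Des (x ⊔ₜ y) ↔ Des x ∨ Des y := by
  cases x <;> cases y <;> simp [Des, BilatticeSig.tJoin, tJoin]

theorem des_kJoin (x y : Four.{u}) : Des (x ⊔ₖ y) ↔ Des x ∨ Des y := by
  cases x <;> cases y <;> simp [Des, BilatticeSig.kJoin, kJoin]

theorem des_imp (x y : Four.{u}) : Des (x ⊃ᵢ y) ↔ (Des x → Des y) := by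
  cases x <;> cases y <;> simp [Des, ImpSig.imp, imp]

theorem des_neg_imp (x y : Four.{u}) : Des (∼ₙ(x ⊃ᵢ y)) ↔ Des x ∧ Des (∼ₙy) := by
  cases x <;> cases y <;> simp [Des, ImpSig.imp, imp, BilatticeSig.neg, neg]

theorem isImplicativeBilattice : IsImplicativeBilattice Four.{u} where
  bilattice :=
    { tLattice := by
        constructor <;> intro a b <;> (try intro c <;> cases c) <;> cases a <;> cases b <;> rfl
      kLattice := by
        constructor <;> intro a b <;> (try intro c <;> cases c) <;> cases a <;> cases b <;> rfl
      neg_tLe := by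
        intro a b
        cases a <;> cases b <;>
          simp [tLe, BilatticeSig.neg, neg, BilatticeSig.tMeet, tMeet]
      neg_kLe := by
        intro a b
        cases a <;> cases b <;>
          simp [kLe, BilatticeSig.neg, neg, BilatticeSig.kMeet, kMeet]
      neg_neg := by intro a; cases a <;> rfl }
  ib1 := by intro x y; cases x <;> cases y <;> rfl
  ib2_t := by intro x y z; cases x <;> cases y <;> cases z <;> rfl
  ib2_k := by intro x y z; cases x <;> cases y <;> cases z <;> rfl
  ib3 := by intro x y; cases x <;> cases y <;> rfl
  ib4_t := by intro x y z; cases x <;> cases y <;> cases z <;> rfl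
  ib4_k := by intro x y z; cases x <;> cases y <;> cases z <;> rfl
  ib5 := by intro x y; cases x <;> cases y <;> rfl
  ib6 := by intro x y z; cases x <;> cases y <;> cases z <;> rfl

theorem isLogicalBilatticeImp : IsLogicalBilatticeImp Four.{u} {x | Des x} where
  bilattice := isImplicativeBilattice.bilattice
  prime :=
    { nonempty := ⟨t, trivial⟩
      proper := fun h => (h ▸ Set.mem_univ f : f ∈ {x : Four.{u} | Des x})
      tMeet_mem := des_tMeet
      kMeet_mem := des_kMeet
      tJoin_mem := des_tJoin
      kJoin_mem := des_kJoin }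
  imp_eq := by
    refine ⟨t, fun a => by cases a <;> rfl, fun a b => ⟨fun h => ?_, fun h => ?_⟩⟩ <;>
      cases a <;> first | rfl | exact h.elim | exact (h trivial).elim

theorem card : Nat.card Four.{u} = 4 := by
  let e : Four.{u} ≃ Fin 4 :=
    { toFun := fun x => match x with
        | f => 0
        | bot => 1
        | top => 2
        | t => 3
      invFun := fun i => match i with
        | 0 => f
        | 1 => bot
        | 2 => top
        | 3 => t
      left_inv := by intro x; cases x <;> rfl
      right_inv := by intro i; fin_cases i <;> rfl }
  rw [Nat.card_congr e, Nat.card_fin]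

/-- The truth value whose designation, and that of its negation, are prescribed. -/
noncomputable def ofProps (p q : Prop) : Four.{u} :=
  open Classical in if p then (if q then top else t) else (if q then f else bot)

theorem des_ofProps (p q : Prop) : Des (ofProps.{u} p q) ↔ p := by
  unfold ofProps; split_ifs <;> simp_all [Des]

theorem des_neg_ofProps (p q : Prop) : Des (∼ₙ(ofProps.{u} p q)) ↔ q := by
  unfold ofProps; split_ifs <;> simp_all [Des, BilatticeSig.neg, neg]

/-- The only subalgebras of `FOUR⊃` are `{top}` and `FOUR⊃`. -/
theorem surjective_of_ne {A : Type v} [ImpSig A] {g : A → Four.{u}} (hg : IsHom g) {a b : A}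
    (hab : g a ≠ g b) : Function.Surjective g := by
  -- Any value other than `top` yields `t`, as itself or through `c ⊃ c`; then `t` and its negation
  -- `f` have `bot` and `top` as knowledge meet and join.
  have key : ∀ c : A, g c ≠ top → Function.Surjective g := by
    intro c hc
    have ht : ∃ d, g d = t := by
      cases h : g c with
      | f => exact ⟨c ⊃ᵢ c, by rw [hg.map_imp, h]; rfl⟩
      | bot => exact ⟨c ⊃ᵢ c, by rw [hg.map_imp, h]; rfl⟩
      | top => exact absurd h hc
      | t => exact ⟨c, h⟩
    obtain ⟨d, hd⟩ := ht
    intro x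
    cases x with
    | f => exact ⟨∼ₙd, by rw [hg.map_neg, hd]; rfl⟩
    | bot => exact ⟨d ⊓ₖ ∼ₙd, by rw [hg.map_kMeet, hg.map_neg, hd]; rfl⟩
    | top => exact ⟨d ⊔ₖ ∼ₙd, by rw [hg.map_kJoin, hg.map_neg, hd]; rfl⟩
    | t => exact ⟨d, hd⟩
  by_cases ha : g a = top
  · exact key b fun hb => hab (ha.trans hb.symm)
  · exact key a ha

/-- `FOUR⊃` is simple. -/
theorem eq_of_map_eq {C : Type v} [ImpSig C] {g : Four.{u} → C} (hg : IsHom g) {a b : Four.{u}}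
    (hab : a ≠ b) (h : g a = g b) (x y : Four.{u}) : g x = g y := by
  -- Identifying a designated `c` with an undesignated `d` identifies `c ⊃ z = z` with `d ⊃ z = t`,
  -- so everything collapses.
  have key : ∀ c d : Four.{u}, Des c → ¬ Des d → g c = g d → ∀ z, g z = g t := by
    intro c d hc hd e z
    have h₁ : c ⊃ᵢ z = z := by cases c <;> first | rfl | exact hc.elim
    have h₂ : d ⊃ᵢ z = t := by cases d <;> first | rfl | exact (hd trivial).elim
    rw [← h₁, ← h₂, hg.map_imp, hg.map_imp, e]
  have main : ∀ z, g z = g t := by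
    have hn : g (∼ₙa) = g (∼ₙb) := by rw [hg.map_neg, hg.map_neg, h]
    by_cases h₁ : Des a ↔ Des b
    · have h₂ : ¬ (Des (∼ₙa) ↔ Des (∼ₙb)) := fun h₂ => hab (ext_des h₁ h₂)
      by_cases ha : Des (∼ₙa)
      · exact key _ _ ha (fun hb => h₂ (iff_of_true ha hb)) hn
      · exact key _ _ (by_contra fun hb => h₂ (iff_of_false ha hb)) ha hn.symm
    · by_cases ha : Des a
      · exact key _ _ ha (fun hb => h₁ (iff_of_true ha hb)) h
      · exact key _ _ (by_contra fun hb => h₁ (iff_of_false ha hb)) ha h.symm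
  rw [main x, main y]

end Four

/-! ### Homomorphisms onto `FOUR⊃` from prime sets -/

/-- The sets that are inverse images of the designated values under homomorphisms to `FOUR⊃`. -/
structure IsFourPrime {A : Type u} [ImpSig A] (P : Set A) : Prop where
  tMeet_mem : ∀ a b, a ⊓ₜ b ∈ P ↔ a ∈ P ∧ b ∈ P
  kMeet_mem : ∀ a b, a ⊓ₖ b ∈ P ↔ a ∈ P ∧ b ∈ P
  tJoin_mem : ∀ a b, a ⊔ₜ b ∈ P ↔ a ∈ P ∨ b ∈ P
  kJoin_mem : ∀ a b, a ⊔ₖ b ∈ P ↔ a ∈ P ∨ b ∈ P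
  imp_mem : ∀ a b, a ⊃ᵢ b ∈ P ↔ (a ∈ P → b ∈ P)
  neg_imp_mem : ∀ a b, ∼ₙ(a ⊃ᵢ b) ∈ P ↔ a ∈ P ∧ ∼ₙb ∈ P

/-- The bits of the image of `a` are `a ∈ P` and `∼ₙa ∈ P`. De Morgan laws settle the second bit for
the lattice operations; implication has no such law, hence the clause `neg_imp_mem`. -/
theorem IsFourPrime.exists_hom {A : Type u} [ImpSig A] (hA : IsBilattice A) {P : Set A}
    (hP : IsFourPrime P) :
    ∃ g : A → Four.{v}, IsHom g ∧ ∀ a, Four.Des (g a) ↔ a ∈ P := by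
  have hF := Four.isImplicativeBilattice.{v}.bilattice
  refine ⟨fun a => Four.ofProps (a ∈ P) (∼ₙa ∈ P), ⟨?_, ?_, ?_, ?_, ?_, ?_⟩,
    fun a => Four.des_ofProps _ _⟩
  · intro a b
    apply Four.ext_des
    · simp only [Four.des_tMeet, Four.des_ofProps, hP.tMeet_mem]
    · simp only [hF.neg_tMeet, Four.des_tJoin, Four.des_neg_ofProps, hA.neg_tMeet, hP.tJoin_mem]
  · intro a b
    apply Four.ext_des
    · simp only [Four.des_tJoin, Four.des_ofProps, hP.tJoin_mem]
    · simp only [hF.neg_tJoin, Four.des_tMeet, Four.des_neg_ofProps, hA.neg_tJoin, hP.tMeet_mem]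
  · intro a b
    apply Four.ext_des
    · simp only [Four.des_kMeet, Four.des_ofProps, hP.kMeet_mem]
    · simp only [hF.neg_kMeet, Four.des_kMeet, Four.des_neg_ofProps, hA.neg_kMeet, hP.kMeet_mem]
  · intro a b
    apply Four.ext_des
    · simp only [Four.des_kJoin, Four.des_ofProps, hP.kJoin_mem]
    · simp only [hF.neg_kJoin, Four.des_kJoin, Four.des_neg_ofProps, hA.neg_kJoin, hP.kJoin_mem]
  · intro a
    apply Four.ext_des
    · simp only [Four.des_ofProps, Four.des_neg_ofProps]
    · simp only [hF.neg_neg, Four.des_ofProps, Four.des_neg_ofProps, hA.neg_neg]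
  · intro a b
    apply Four.ext_des
    · simp only [Four.des_imp, Four.des_ofProps, hP.imp_mem]
    · simp only [Four.des_neg_imp, Four.des_ofProps, Four.des_neg_ofProps, hP.neg_imp_mem]

/-- The truth maximum lies in `F`, and its negation, the truth minimum, does not, as `F` is proper.
This settles the implications with antecedent outside `F`. -/
theorem IsLogicalBilatticeImp.isFourPrime {B : Type u} [ImpSig B] {F : Set B}
    (h : IsLogicalBilatticeImp B F) : IsFourPrime F := by
  obtain ⟨t, ht, himp⟩ := h.imp_eq
  have htF : t ∈ F := by
    obtain ⟨a, ha⟩ := h.prime.nonempty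
    rw [← ht a] at ha
    exact ((h.prime.tMeet_mem _ _).1 ha).2
  have hnt : ∼ₙt ∉ F := by
    intro hm
    apply h.prime.proper
    refine Set.eq_univ_of_forall fun a => ?_
    have e := h.bilattice.neg_tLe _ _ (ht (∼ₙa))
    rw [h.bilattice.neg_neg] at e
    rw [← e] at hm
    exact ((h.prime.tMeet_mem _ _).1 hm).2
  refine ⟨h.prime.tMeet_mem, h.prime.kMeet_mem, h.prime.tJoin_mem, h.prime.kJoin_mem, ?_, ?_⟩ <;>
    intro a b <;> by_cases ha : a ∈ F
  · simp [(himp a b).2 ha, ha]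
  · simp [(himp a b).1 ha, ha, htF]
  · simp [(himp a b).2 ha, ha]
  · simp [(himp a b).1 ha, ha, hnt]

/-! ### Implicative bilattices -/

/-- The elements that act as the identity by implication. -/
def unitSet (A : Type u) [ImpSig A] : Set A := {d | ∀ y : A, d ⊃ᵢ y = y}

/-- The deductive filters: the sets that contain `unitSet A` and are closed under modus ponens. -/
structure IsDeductive {A : Type u} [ImpSig A] (P : Set A) : Prop where
  unit_mem : ∀ d ∈ unitSet A, d ∈ P
  mp : ∀ x y, x ∈ P → x ⊃ᵢ y ∈ P → y ∈ P

namespace IsImplicativeBilattice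

variable {A : Type u} [ImpSig A]

/-! ### Calculus of implication and deductive filters. -/

theorem imp_comm (h : IsImplicativeBilattice A) (x y z : A) : x ⊃ᵢ (y ⊃ᵢ z) = y ⊃ᵢ (x ⊃ᵢ z) := by
  rw [h.ib2_t, h.bilattice.tLattice.meet_comm, ← h.ib2_t]

theorem imp_idem (h : IsImplicativeBilattice A) (x z : A) : x ⊃ᵢ (x ⊃ᵢ z) = x ⊃ᵢ z := by
  rw [h.ib2_t, h.bilattice.tLattice.meet_idem]

theorem imp_self_mem (h : IsImplicativeBilattice A) (x : A) : x ⊃ᵢ x ∈ unitSet A :=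
  fun y => h.ib1 x y

/-- For a unit `d`, Peirce's law `ib3` shrinks to `(y ⊃ d) ⊃ d = d`; by exchange, `y ⊃ d` is then `e
⊃ e` with `e = y ⊃ d`. -/
theorem imp_mem_unitSet (h : IsImplicativeBilattice A) (y : A) {d : A} (hd : d ∈ unitSet A) :
    y ⊃ᵢ d ∈ unitSet A := by
  have h₁ : (y ⊃ᵢ d) ⊃ᵢ d = d := by
    have := h.ib3 d y
    rwa [hd, hd d] at this
  have h₂ : (y ⊃ᵢ d) ⊃ᵢ (y ⊃ᵢ d) = y ⊃ᵢ d := by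
    rw [h.imp_comm, h₁]
  rw [← h₂]
  exact h.imp_self_mem _

theorem imp_imp_self_mem (h : IsImplicativeBilattice A) (x y : A) : x ⊃ᵢ (y ⊃ᵢ x) ∈ unitSet A := by
  rw [h.imp_comm]
  exact h.imp_mem_unitSet y (h.imp_self_mem x)

theorem le_kMeet_of_imp_mem (h : IsImplicativeBilattice A) {x y : A} (hxy : x ⊃ᵢ y ∈ unitSet A) :
    x ⊓ₜ (x ⊓ₖ y) = x := by
  have := h.ib5 x y
  rwa [hxy] at this

/-- By `ib5`, `x` equals its truth meet with `x ⊗ y`, and meets in an antecedent unfold into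
iterated implications. With the converse below, this makes entailment equational. -/
theorem imp_imp_of_imp_mem (h : IsImplicativeBilattice A) {x y : A} (hxy : x ⊃ᵢ y ∈ unitSet A)
    (z : A) : x ⊃ᵢ (y ⊃ᵢ z) = x ⊃ᵢ z := by
  conv_rhs => rw [← h.le_kMeet_of_imp_mem hxy]
  rw [← h.ib2_t, ← h.ib2_k, ← h.ib2_t, h.imp_idem]

theorem imp_mem_of_imp_imp (h : IsImplicativeBilattice A) {x y : A}
    (hxy : ∀ z, x ⊃ᵢ (y ⊃ᵢ z) = x ⊃ᵢ z) : x ⊃ᵢ y ∈ unitSet A := by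
  rw [← hxy]
  exact h.imp_mem_unitSet x (h.imp_self_mem y)

/-- Frege's axiom up to exchange. The antecedents `c ⊃ z` and `c` together entail `z`, so `z` can be
inserted as a further antecedent; exchange then leaves an implication whose consequent is of the
form `e ⊃ e`. -/
theorem imp_distrib_mem (h : IsImplicativeBilattice A) (c z w : A) :
    (c ⊃ᵢ z) ⊃ᵢ ((c ⊃ᵢ (z ⊃ᵢ w)) ⊃ᵢ (c ⊃ᵢ w)) ∈ unitSet A := by
  have hle : ((c ⊃ᵢ z) ⊓ₜ c) ⊃ᵢ z ∈ unitSet A := by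
    rw [← h.ib2_t]
    exact h.imp_self_mem _
  rw [h.imp_comm (c ⊃ᵢ (z ⊃ᵢ w)) c w, h.ib2_t, ← h.imp_imp_of_imp_mem hle,
    h.imp_comm z, ← h.ib2_t, h.imp_comm c]
  exact h.imp_mem_unitSet _ (h.imp_self_mem _)

theorem isDeductive_unitSet : IsDeductive (unitSet A) :=
  ⟨fun _ hd => hd, fun x y hx hxy => by rwa [hx] at hxy⟩

/-- The deduction theorem: this set plays the role of the filter generated by `P` and `c`. -/
theorem isDeductive_adjoin (h : IsImplicativeBilattice A) {P : Set A} (hP : IsDeductive P) (c : A) :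
    IsDeductive {z | c ⊃ᵢ z ∈ P} where
  unit_mem _ hd := hP.unit_mem _ (h.imp_mem_unitSet c hd)
  mp x y hx hxy := hP.mp _ _ hxy (hP.mp _ _ hx (hP.unit_mem _ (h.imp_distrib_mem c x y)))

theorem mem_of_imp_imp (h : IsImplicativeBilattice A) {P : Set A} (hP : IsDeductive P) {x y : A}
    (hxy : ∀ z, x ⊃ᵢ (y ⊃ᵢ z) = x ⊃ᵢ z) (hx : x ∈ P) : y ∈ P :=
  hP.mp _ _ hx (hP.unit_mem _ (h.imp_mem_of_imp_imp hxy))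

/-- Turns the axioms that compare antecedents (`ib2_k`, `ib4_t`, `ib4_k`, `ib6`) into membership
conditions. -/
theorem mem_congr (h : IsImplicativeBilattice A) {P : Set A} (hP : IsDeductive P) {x y : A}
    (hxy : ∀ z, x ⊃ᵢ z = y ⊃ᵢ z) : x ∈ P ↔ y ∈ P :=
  ⟨h.mem_of_imp_imp hP fun z => by rw [← hxy, h.imp_idem],
    h.mem_of_imp_imp hP fun z => by rw [hxy, h.imp_idem]⟩

theorem tMeet_mem (h : IsImplicativeBilattice A) {P : Set A} (hP : IsDeductive P) (x y : A) :
    x ⊓ₜ y ∈ P ↔ x ∈ P ∧ y ∈ P := by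
  refine ⟨fun hm => ⟨?_, ?_⟩, fun ⟨hx, hy⟩ => ?_⟩
  · exact h.mem_of_imp_imp hP (fun z => by simp only [← h.ib2_t, h.imp_comm y x, h.imp_idem]) hm
  · exact h.mem_of_imp_imp hP (fun z => by simp only [← h.ib2_t, h.imp_idem]) hm
  · have := hP.unit_mem _ (h.imp_self_mem (x ⊓ₜ y))
    rw [← h.ib2_t] at this
    exact hP.mp _ _ hy (hP.mp _ _ hx this)

/-- Deductive filters that are maximal among those that omit a given element are prime. -/
theorem isFourPrime_of_maximal (h : IsImplicativeBilattice A) {P : Set A} {b : A}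
    (hP : IsDeductive P) (hb : b ∉ P)
    (hmax : ∀ Q, IsDeductive Q → b ∉ Q → P ⊆ Q → Q ⊆ P) : IsFourPrime P := by
  -- Otherwise adjoining `c` to `P` gives a deductive filter that still omits `b`, so maximality
  -- puts `c` in `P`.
  have himpb : ∀ c, c ∉ P → c ⊃ᵢ b ∈ P := by
    intro c hc
    by_contra hcb
    exact hc (hmax _ (h.isDeductive_adjoin hP c) hcb
      (fun z hz => hP.mp _ _ hz (hP.unit_mem _ (h.imp_imp_self_mem z c)))
      (hP.unit_mem _ (h.imp_self_mem c)))
  have hcongr := fun {x y : A} => h.mem_congr hP (x := x) (y := y)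
  have hmeet := h.tMeet_mem hP
  have hjoin : ∀ x y, x ⊔ₜ y ∈ P ↔ x ∈ P ∨ y ∈ P := by
    intro x y
    constructor
    · intro hxy
      by_contra hne
      rw [not_or] at hne
      have := (hmeet _ _).2 ⟨himpb x hne.1, himpb y hne.2⟩
      rw [← h.ib4_t] at this
      exact hb (hP.mp _ _ hxy this)
    · rintro (hx | hy)
      · rw [← h.bilattice.tLattice.meet_join_self x y] at hx
        exact ((hmeet _ _).1 hx).2
      · rw [← h.bilattice.tLattice.le_join_right x y] at hy
        exact ((hmeet _ _).1 hy).2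
  refine ⟨hmeet, ?_, hjoin, ?_, ?_, ?_⟩
  · intro x y
    rw [← hmeet]
    exact hcongr fun z => (h.ib2_k x y z).symm
  · intro x y
    rw [← hjoin]
    exact hcongr fun z => by rw [h.ib4_t, h.ib4_k]
  · intro x y
    refine ⟨fun hxy hx => hP.mp _ _ hx hxy, fun hxy => ?_⟩
    by_contra hne
    have hx : x ∉ P := fun hx =>
      hne (hP.mp _ _ (hxy hx) (hP.unit_mem _ (h.imp_imp_self_mem y x)))
    -- Both `x ⊃ b` and `(x ⊃ y) ⊃ b` lie in `P`. Chaining gives `(b ⊃ y) ⊃ b ∈ P`, and Peirce's law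
    -- yields the forbidden `b ∈ P`.
    have h₁ : (b ⊃ᵢ y) ⊃ᵢ (x ⊃ᵢ y) ∈ P := by
      rw [h.imp_comm]
      refine (h.isDeductive_adjoin hP x).mp b _ (himpb x hx)
        ((h.isDeductive_adjoin hP x).unit_mem _ ?_)
      rw [h.imp_comm]
      exact h.imp_self_mem _
    have h₂ : (b ⊃ᵢ y) ⊃ᵢ b ∈ P :=
      (h.isDeductive_adjoin hP (b ⊃ᵢ y)).mp _ _ h₁
        (hP.mp _ _ (himpb _ hne) (hP.unit_mem _ (h.imp_imp_self_mem _ _)))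
    refine hb (hP.mp _ _ h₂ (hP.unit_mem _ ?_))
    rw [h.ib3]
    exact h.imp_self_mem b
  · intro x y
    rw [← hmeet]
    exact hcongr fun z => h.ib6 x y z

/-- Zorn's lemma is started at the filter of all `z` with `a ⊃ z` a unit, which contains `a` and
omits `b`. -/
theorem exists_isFourPrime (h : IsImplicativeBilattice A) {a b : A} (hab : a ⊃ᵢ b ∉ unitSet A) :
    ∃ P : Set A, IsFourPrime P ∧ a ∈ P ∧ b ∉ P := by
  obtain ⟨P, haP, hP⟩ := zorn_subset_nonempty {Q : Set A | IsDeductive Q ∧ b ∉ Q} (by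
    intro c hc hchain ⟨Q₀, hQ₀⟩
    refine ⟨⋃₀ c, ⟨⟨?_, ?_⟩, ?_⟩, fun s hs => Set.subset_sUnion_of_mem hs⟩
    · exact fun d hd => ⟨Q₀, hQ₀, (hc hQ₀).1.unit_mem d hd⟩
    · rintro x y ⟨Q, hQ, hx⟩ ⟨R, hR, hxy⟩
      rcases hchain.total hQ hR with hle | hle
      · exact ⟨R, hR, (hc hR).1.mp _ _ (hle hx) hxy⟩
      · exact ⟨Q, hQ, (hc hQ).1.mp _ _ hx (hle hxy)⟩
    · rintro ⟨Q, hQ, hbQ⟩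
      exact (hc hQ).2 hbQ)
    {z | a ⊃ᵢ z ∈ unitSet A} ⟨h.isDeductive_adjoin isDeductive_unitSet a, hab⟩
  exact ⟨P, h.isFourPrime_of_maximal hP.prop.1 hP.prop.2
    (fun Q hQ hbQ hle => hP.le_of_ge ⟨hQ, hbQ⟩ hle), haP (h.imp_self_mem a), hP.prop.2⟩

/-- By `ib5`, `a` is truth-below `a ⊗ b`; the same for the negations, negated back, gives the
reverse inequality. -/
theorem eq_kMeet_of_imp_mem (h : IsImplicativeBilattice A) {a b : A} (h₁ : a ⊃ᵢ b ∈ unitSet A)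
    (h₂ : ∼ₙa ⊃ᵢ ∼ₙb ∈ unitSet A) : a = a ⊓ₖ b := by
  refine h.bilattice.tLattice.antisymm (h.le_kMeet_of_imp_mem h₁) ?_
  have := h.bilattice.neg_tLe _ _ (h.le_kMeet_of_imp_mem h₂)
  rwa [← h.bilattice.neg_kMeet, h.bilattice.neg_neg, h.bilattice.neg_neg] at this

/-- Homomorphisms to `FOUR⊃` separate the points of an implicative bilattice. -/
theorem exists_hom_ne (h : IsImplicativeBilattice A) {a b : A} (hab : a ≠ b) :
    ∃ g : A → Four.{v}, IsHom g ∧ g a ≠ g b := by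
  by_contra hne
  push Not at hne
  have key : ∀ c d : A, (∀ g : A → Four.{v}, IsHom g → Four.Des (g c) → Four.Des (g d)) →
      c ⊃ᵢ d ∈ unitSet A := by
    intro c d hcd
    by_contra hn
    obtain ⟨P, hP, hc, hd⟩ := h.exists_isFourPrime hn
    obtain ⟨g, hg, hgP⟩ := hP.exists_hom.{u, v} h.bilattice
    exact hd ((hgP d).1 (hcd g hg ((hgP c).2 hc)))
  apply hab
  rw [h.eq_kMeet_of_imp_mem (a := a) (b := b) (key _ _ fun g hg => by rw [hne g hg]; exact id)
    (key _ _ fun g hg => by rw [hg.map_neg, hg.map_neg, hne g hg]; exact id),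
    h.bilattice.kLattice.meet_comm]
  exact (h.eq_kMeet_of_imp_mem (key _ _ fun g hg => by rw [hne g hg]; exact id)
    (key _ _ fun g hg => by rw [hg.map_neg, hg.map_neg, hne g hg]; exact id)).symm

end IsImplicativeBilattice

/-! ### The variety of implicative bilattices -/

theorem isImplicativeBilattice_of_injective {A : Type u} {B : Type v} [ImpSig A] [ImpSig B]
    {f : B → A} (hA : IsImplicativeBilattice A) (hf : IsHom f) (inj : Function.Injective f) :
    IsImplicativeBilattice B := by
  have ht := hA.bilattice.tLattice
  have hk := hA.bilattice.kLattice
  refine ⟨⟨⟨?_, ?_, ?_, ?_, ?_, ?_⟩, ⟨?_, ?_, ?_, ?_, ?_, ?_⟩, ?_, ?_, ?_⟩,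
    ?_, ?_, ?_, ?_, ?_, ?_, ?_, ?_⟩ <;> intros <;> (try unfold tLe kLe at *) <;> apply inj <;>
    simp only [hf.map_tMeet, hf.map_tJoin, hf.map_kMeet, hf.map_kJoin, hf.map_neg, hf.map_imp]
  · apply ht.meet_comm
  · apply ht.join_comm
  · apply ht.meet_assoc
  · apply ht.join_assoc
  · apply ht.meet_join_self
  · apply ht.join_meet_self
  · apply hk.meet_comm
  · apply hk.join_comm
  · apply hk.meet_assoc
  · apply hk.join_assoc
  · apply hk.meet_join_self
  · apply hk.join_meet_self
  · rename_i e
    apply hA.bilattice.neg_tLe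
    rw [tLe, ← hf.map_tMeet, e]
  · rename_i e
    apply hA.bilattice.neg_kLe
    rw [kLe, ← hf.map_kMeet, e]
  · apply hA.bilattice.neg_neg
  · apply hA.ib1
  · apply hA.ib2_t
  · apply hA.ib2_k
  · apply hA.ib3
  · apply hA.ib4_t
  · apply hA.ib4_k
  · apply hA.ib5
  · apply hA.ib6

theorem isImplicativeBilattice_of_surjective {A : Type u} {B : Type v} [ImpSig A] [ImpSig B]
    {f : A → B} (hA : IsImplicativeBilattice A) (hf : IsHom f) (surj : Function.Surjective f) :
    IsImplicativeBilattice B := by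
  have ht := hA.bilattice.tLattice
  have hk := hA.bilattice.kLattice
  refine ⟨⟨⟨?_, ?_, ?_, ?_, ?_, ?_⟩, ⟨?_, ?_, ?_, ?_, ?_, ?_⟩, ?_, ?_, ?_⟩,
    ?_, ?_, ?_, ?_, ?_, ?_, ?_, ?_⟩ <;> refine surj.forall.2 fun a => ?_ <;>
    (try refine surj.forall.2 fun b => ?_) <;> (try refine surj.forall.2 fun c => ?_) <;>
    (try intro e) <;>
    simp only [← hf.map_tMeet, ← hf.map_tJoin, ← hf.map_kMeet, ← hf.map_kJoin, ← hf.map_neg,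
      ← hf.map_imp]
  · rw [ht.meet_comm]
  · rw [ht.join_comm]
  · rw [ht.meet_assoc]
  · rw [ht.join_assoc]
  · rw [ht.meet_join_self]
  · rw [ht.join_meet_self]
  · rw [hk.meet_comm]
  · rw [hk.join_comm]
  · rw [hk.meet_assoc]
  · rw [hk.join_assoc]
  · rw [hk.meet_join_self]
  · rw [hk.join_meet_self]
  -- An inequality in the image need not lift, so `a` is replaced by `a ⊓ₜ b`, which has the same
  -- image and does lie below `b`.
  · unfold tLe at e ⊢
    rw [← hf.map_tMeet] at e
    rw [hf.map_neg a, ← e, ← hf.map_neg, ← hf.map_tMeet,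
      hA.bilattice.neg_tLe _ _ (ht.meet_le_right a b)]
  · unfold kLe at e ⊢
    rw [← hf.map_kMeet] at e
    rw [hf.map_neg a, ← e, ← hf.map_neg, ← hf.map_kMeet,
      hA.bilattice.neg_kLe _ _ (hk.meet_le_right a b)]
  · rw [hA.bilattice.neg_neg]
  · rw [hA.ib1]
  · rw [hA.ib2_t]
  · rw [hA.ib2_k]
  · rw [hA.ib3]
  · rw [hA.ib4_t]
  · rw [hA.ib4_k]
  · rw [hA.ib5]
  · rw [hA.ib6]

theorem isImplicativeBilattice_pi {I : Type u} (C : I → Type v) [∀ i, ImpSig (C i)]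
    (hC : ∀ i, IsImplicativeBilattice (C i)) : IsImplicativeBilattice (∀ i, C i) where
  bilattice :=
    { tLattice := by
        constructor <;> intros <;> funext i
        · apply (hC i).bilattice.tLattice.meet_comm
        · apply (hC i).bilattice.tLattice.join_comm
        · apply (hC i).bilattice.tLattice.meet_assoc
        · apply (hC i).bilattice.tLattice.join_assoc
        · apply (hC i).bilattice.tLattice.meet_join_self
        · apply (hC i).bilattice.tLattice.join_meet_self
      kLattice := by
        constructor <;> intros <;> funext i
        · apply (hC i).bilattice.kLattice.meet_comm
        · apply (hC i).bilattice.kLattice.join_comm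
        · apply (hC i).bilattice.kLattice.meet_assoc
        · apply (hC i).bilattice.kLattice.join_assoc
        · apply (hC i).bilattice.kLattice.meet_join_self
        · apply (hC i).bilattice.kLattice.join_meet_self
      neg_tLe := fun a b e => funext fun i => (hC i).bilattice.neg_tLe _ _ (congrFun e i)
      neg_kLe := fun a b e => funext fun i => (hC i).bilattice.neg_kLe _ _ (congrFun e i)
      neg_neg := fun a => funext fun i => (hC i).bilattice.neg_neg _ }
  ib1 _ _ := funext fun i => (hC i).ib1 _ _
  ib2_t _ _ _ := funext fun i => (hC i).ib2_t _ _ _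
  ib2_k _ _ _ := funext fun i => (hC i).ib2_k _ _ _
  ib3 _ _ := funext fun i => (hC i).ib3 _ _
  ib4_t _ _ _ := funext fun i => (hC i).ib4_t _ _ _
  ib4_k _ _ _ := funext fun i => (hC i).ib4_k _ _ _
  ib5 _ _ := funext fun i => (hC i).ib5 _ _
  ib6 _ _ _ := funext fun i => (hC i).ib6 _ _ _

theorem isVariety_impBiLat : IsVariety ImpBiLat.{u} where
  image _ _ _ hA hf surj := isImplicativeBilattice_of_surjective hA hf surj
  sub _ _ _ hA hf inj := isImplicativeBilattice_of_injective hA hf inj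
  prod _ C hC := isImplicativeBilattice_pi (fun i => C i) hC

theorem varietyGen_FOURimp : varietyGen.{u} {FOURimp.{u}} = ImpBiLat.{u} := by
  apply Set.Subset.antisymm
  · exact Set.sInter_subset_of_mem
      ⟨isVariety_impBiLat, Set.singleton_subset_iff.2 Four.isImplicativeBilattice⟩
  · rintro A hA V ⟨hV, hmem⟩
    refine hV.sub _ A (fun a (g : {g : A → Four.{u} // IsHom g}) => g.1 a)
      (hV.prod {g : A → Four.{u} // IsHom g} (fun _ => FOURimp) fun _ => hmem rfl)
      ⟨fun a b => funext fun g => g.2.map_tMeet a b, fun a b => funext fun g => g.2.map_tJoin a b,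
        fun a b => funext fun g => g.2.map_kMeet a b, fun a b => funext fun g => g.2.map_kJoin a b,
        fun a => funext fun g => g.2.map_neg a, fun a b => funext fun g => g.2.map_imp a b⟩ ?_
    intro a b e
    by_contra hab
    obtain ⟨g, hg, hne⟩ := IsImplicativeBilattice.exists_hom_ne.{u, u} hA hab
    exact hne (congrFun e ⟨g, hg⟩)

theorem subdirectlyIrreducible_iff (A : ImpAlg.{u}) (hA : A ∈ ImpBiLat.{u}) [Nontrivial A] :
    SubdirectlyIrreducible A ↔ Isomorphic A FOURimp.{u} := by
  constructor
  · intro hsi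
    have hsep : ∀ {a b : A}, a ≠ b →
        ∃ g : A → Four.{u}, (IsHom g ∧ Function.Surjective g) ∧ g a ≠ g b := by
      intro a b hab
      obtain ⟨g, hg, hne⟩ := IsImplicativeBilattice.exists_hom_ne.{u, u} hA hab
      exact ⟨g, ⟨hg, Four.surjective_of_ne hg hne⟩, hne⟩
    obtain ⟨a₀, b₀, hab₀⟩ := exists_pair_ne A
    obtain ⟨g₀, hg₀, -⟩ := hsep hab₀
    have : Nonempty {g : A → Four.{u} // IsHom g ∧ Function.Surjective g} := ⟨⟨g₀, hg₀⟩⟩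
    obtain ⟨g, hg⟩ := hsi {g : A → Four.{u} // IsHom g ∧ Function.Surjective g}
      (fun _ => FOURimp) (fun a g => g.1 a)
      ⟨fun a b => funext fun g => g.2.1.map_tMeet a b,
        fun a b => funext fun g => g.2.1.map_tJoin a b,
        fun a b => funext fun g => g.2.1.map_kMeet a b,
        fun a b => funext fun g => g.2.1.map_kJoin a b,
        fun a => funext fun g => g.2.1.map_neg a,
        fun a b => funext fun g => g.2.1.map_imp a b⟩
      (by
        intro a b e
        by_contra hab
        obtain ⟨g, hg, hne⟩ := hsep hab
        exact hne (congrFun e ⟨g, hg⟩))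
      (fun g => g.2.2)
    exact ⟨g.1, g.2.1, hg⟩
  · rintro ⟨f, hf, hbij⟩ I _ C α hα inj surj
    obtain ⟨e, hef, hfe⟩ := Function.bijective_iff_has_inverse.1 hbij
    have he := hf.inverse hef hfe
    -- Each projection is onto, hence not injective, hence constant because `FOUR⊃` is simple; then
    -- `α` is constant on a non-trivial algebra.
    by_contra hno
    push Not at hno
    have hproj : ∀ i, IsHom fun a : A => α a i := fun i =>
      ⟨fun a b => congrFun (hα.map_tMeet a b) i, fun a b => congrFun (hα.map_tJoin a b) i,
        fun a b => congrFun (hα.map_kMeet a b) i, fun a b => congrFun (hα.map_kJoin a b) i,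
        fun a => congrFun (hα.map_neg a) i, fun a b => congrFun (hα.map_imp a b) i⟩
    obtain ⟨a₀, b₀, hab₀⟩ := exists_pair_ne A
    refine hab₀ (inj (funext fun i => ?_))
    have hni : ¬ Function.Injective fun a => α a i := fun hi => hno i ⟨hi, surj i⟩
    simp only [Function.Injective, not_forall] at hni
    obtain ⟨a, b, heq, hab⟩ := hni
    have := Four.eq_of_map_eq ((hproj i).comp he) (a := f a) (b := f b)
      (fun h => hab (hbij.1 h)) (by rw [hef, hef]; exact heq) (f a₀) (f b₀)
    rwa [hef, hef] at this

/-! ### The logic `LB⊃` -/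

/-- The conjunction of the implications between two elements and between their negations. -/
def biimp {A : Type u} [ImpSig A] (a b : A) : A :=
  ((a ⊃ᵢ b) ⊓ₜ (b ⊃ᵢ a)) ⊓ₜ ((∼ₙa ⊃ᵢ ∼ₙb) ⊓ₜ (∼ₙb ⊃ᵢ ∼ₙa))

theorem IsHom.map_biimp {A : Type*} {B : Type*} [ImpSig A] [ImpSig B] {f : A → B} (hf : IsHom f)
    (a b : A) : f (biimp a b) = biimp (f a) (f b) := by
  simp only [biimp, hf.map_tMeet, hf.map_imp, hf.map_neg]

/-- The two pairs of implications compare the two bits. -/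
theorem Four.des_biimp (x y : Four.{u}) : Des (biimp x y) ↔ x = y := by
  simp only [biimp, des_tMeet, des_imp]
  refine ⟨fun ⟨⟨h₁, h₂⟩, h₃, h₄⟩ => ext_des ⟨h₁, h₂⟩ ⟨h₃, h₄⟩, ?_⟩
  rintro rfl
  exact ⟨⟨id, id⟩, id, id⟩

/-- The value of a formula under an assignment of its variables. -/
def Fm.eval {A : Type u} [ImpSig A] (s : ℕ → A) : Fm → A
  | .var n => s n
  | .tMeet p q => p.eval s ⊓ₜ q.eval s
  | .tJoin p q => p.eval s ⊔ₜ q.eval s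
  | .kMeet p q => p.eval s ⊓ₖ q.eval s
  | .kJoin p q => p.eval s ⊔ₖ q.eval s
  | .imp p q => p.eval s ⊃ᵢ q.eval s
  | .neg p => ∼ₙ(p.eval s)

theorem Fm.isHom_eval {A : Type u} [ImpSig A] (s : ℕ → A) : IsHom (Fm.eval s) :=
  ⟨fun _ _ => rfl, fun _ _ => rfl, fun _ _ => rfl, fun _ _ => rfl, fun _ => rfl, fun _ _ => rfl⟩

/-- Every defining matrix of `LB⊃` has as filter the inverse image of the designated values under a
homomorphism to `FOUR⊃`. -/
theorem LBimp_iff (Γ : Set Fm) (φ : Fm) :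
    LBimp.{v} Γ φ ↔ MatrixEntails {x : Four.{v} | Four.Des x} Γ φ := by
  refine ⟨fun h => h _ _ Four.isLogicalBilatticeImp, fun h B _ F hF s hs hΓ => ?_⟩
  obtain ⟨g, hg, hgF⟩ := hF.isFourPrime.exists_hom.{v, v} hF.bilattice
  exact (hgF _).1 (h _ (hg.comp hs) fun γ hγ => (hgF _).2 (hΓ γ hγ))

theorem IsImplicativeBilattice.mem_algStar (A : ImpAlg.{u}) (hA : IsImplicativeBilattice A) :
    A ∈ AlgStar.{u} LBimp.{v} := by
  let D : Set A := {a | ∀ g : A → Four.{v}, IsHom g → Four.Des (g a)}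
  refine ⟨D, ?_, ⟨⟨?_, ?_⟩, ?_⟩⟩
  · intro Γ φ hL s hs hΓ g hg
    exact (LBimp_iff Γ φ).1 hL _ (hg.comp hs) fun γ hγ => hΓ γ hγ g hg
  · constructor <;> intros <;> simp_all
  · rintro a b ha rfl
    exact ha
  · rintro θ ⟨hθ, hD⟩ a b hab
    by_contra hne
    obtain ⟨g, hg, hgne⟩ := exists_hom_ne.{u, v} hA hne
    -- `biimp a a` lies in `D` and is `θ`-related to `biimp a b`, so compatibility applies; every
    -- homomorphism to `FOUR⊃` then identifies `a` and `b`.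
    have h₁ : biimp a b ∈ D := by
      refine hD (biimp a a) _ (fun g hg => ?_) ?_
      · rw [hg.map_biimp, Four.des_biimp]
      · have hr := θ.refl
        exact hθ.tMeet (hθ.tMeet (hθ.imp (hr a) hab) (hθ.imp hab (hr a)))
          (hθ.tMeet (hθ.imp (hr _) (hθ.neg hab)) (hθ.imp (hθ.neg hab) (hr _)))
    have h₂ := h₁ g hg
    rw [hg.map_biimp, Four.des_biimp] at h₂
    exact hgne h₂

/-! ### Models of `LB⊃`: transfer of rules and the congruence defined by `biimp`. -/

theorem IsHom.eq_eval {A : Type u} [ImpSig A] {h : Fm → A} (hh : IsHom h) (φ : Fm) :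
    h φ = φ.eval fun n => h (.var n) := by
  induction φ with
  | var n => rfl
  | tMeet p q hp hq => exact (hh.map_tMeet p q).trans (by rw [hp, hq]; rfl)
  | tJoin p q hp hq => exact (hh.map_tJoin p q).trans (by rw [hp, hq]; rfl)
  | kMeet p q hp hq => exact (hh.map_kMeet p q).trans (by rw [hp, hq]; rfl)
  | kJoin p q hp hq => exact (hh.map_kJoin p q).trans (by rw [hp, hq]; rfl)
  | imp p q hp hq => exact (hh.map_imp p q).trans (by rw [hp, hq]; rfl)
  | neg p hp => exact (hh.map_neg p).trans (by rw [hp]; rfl)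

theorem mem_of_forall_four {A : Type u} [ImpSig A] {D : Set A} (hD : IsModel LBimp.{v} D)
    (s : ℕ → A) (Γ : Set Fm) (φ : Fm)
    (H : ∀ r : ℕ → Four.{v}, (∀ γ ∈ Γ, Four.Des (γ.eval r)) → Four.Des (φ.eval r))
    (hΓ : ∀ γ ∈ Γ, γ.eval s ∈ D) : φ.eval s ∈ D := by
  refine hD Γ φ ((LBimp_iff Γ φ).2 fun r hr hrΓ => ?_) _ (Fm.isHom_eval s) hΓ
  change Four.Des (r φ)
  rw [hr.eq_eval]
  exact H _ fun γ hγ => by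
    rw [← hr.eq_eval]
    exact hrΓ γ hγ

/-- Quasi-identities of `FOUR⊃` hold for `biimp` in the models of `LB⊃`. -/
theorem biimp_mem_of_forall_four {A : Type u} [ImpSig A] {D : Set A} (hD : IsModel LBimp.{v} D)
    (s : ℕ → A) (p₁ q₁ p₂ q₂ p q : Fm)
    (H : ∀ r : ℕ → Four.{v}, p₁.eval r = q₁.eval r → p₂.eval r = q₂.eval r → p.eval r = q.eval r)
    (h₁ : biimp (p₁.eval s) (q₁.eval s) ∈ D) (h₂ : biimp (p₂.eval s) (q₂.eval s) ∈ D) :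
    biimp (p.eval s) (q.eval s) ∈ D := by
  rw [← (Fm.isHom_eval s).map_biimp] at h₁ h₂ ⊢
  refine mem_of_forall_four hD s {biimp p₁ q₁, biimp p₂ q₂} _ (fun r hr => ?_) ?_
  · have e₁ := hr (biimp p₁ q₁) (by simp)
    have e₂ := hr (biimp p₂ q₂) (by simp)
    rw [(Fm.isHom_eval r).map_biimp, Four.des_biimp] at e₁ e₂ ⊢
    exact H r e₁ e₂
  · rintro γ (rfl | rfl)
    · exact h₁
    · exact h₂

theorem biimp_mem_of_identity {A : Type u} [ImpSig A] {D : Set A} (hD : IsModel LBimp.{v} D)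
    (s : ℕ → A) (p q : Fm) (H : ∀ r : ℕ → Four.{v}, p.eval r = q.eval r) :
    biimp (p.eval s) (q.eval s) ∈ D := by
  rw [← (Fm.isHom_eval s).map_biimp]
  refine mem_of_forall_four hD s ∅ _ (fun r _ => ?_) (by simp)
  rw [(Fm.isHom_eval r).map_biimp, Four.des_biimp]
  exact H r

/-- The assignment of given values to the first four variables. -/
def assign {A : Type u} (a b c d : A) : ℕ → A
  | 0 => a
  | 1 => b
  | 2 => c
  | _ => d

/-- The matrix congruence of a model of `LB⊃` that is defined by `biimp`. -/
def biimpSetoid {A : Type u} [ImpSig A] {D : Set A} (hD : IsModel LBimp.{v} D) : Setoid A where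
  r a b := biimp a b ∈ D
  iseqv :=
    { refl := fun a => biimp_mem_of_identity hD (assign a a a a) (.var 0) (.var 0) fun _ => rfl
      -- The transfer lemma takes two premises; a rule with only one repeats it.
      symm := fun {a b} h => biimp_mem_of_forall_four hD (assign a b a a) (.var 0) (.var 1)
        (.var 0) (.var 1) (.var 1) (.var 0) (fun _ e _ => e.symm) h h
      trans := fun {a b c} h₁ h₂ => biimp_mem_of_forall_four hD (assign a b c c) (.var 0) (.var 1)
        (.var 1) (.var 2) (.var 0) (.var 2) (fun _ => Eq.trans) h₁ h₂ }

/-- Since `biimp` expresses equality in `FOUR⊃`, replacement of equals there becomes the congruence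
property here; compatibility is the rule from `x` and `biimp x y` to `y`. -/
theorem biimpSetoid_mem_matrixCongruences {A : Type u} [ImpSig A] {D : Set A}
    (hD : IsModel LBimp.{v} D) : biimpSetoid hD ∈ matrixCongruences D := by
  refine ⟨⟨?_, ?_, ?_, ?_, ?_, ?_⟩, ?_⟩
  · exact fun {a b c d} h₁ h₂ => biimp_mem_of_forall_four hD (assign a b c d) (.var 0) (.var 1)
      (.var 2) (.var 3) (.tMeet (.var 0) (.var 2)) (.tMeet (.var 1) (.var 3))
      (fun _ e₁ e₂ => by simp only [Fm.eval] at *; rw [e₁, e₂]) h₁ h₂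
  · exact fun {a b c d} h₁ h₂ => biimp_mem_of_forall_four hD (assign a b c d) (.var 0) (.var 1)
      (.var 2) (.var 3) (.tJoin (.var 0) (.var 2)) (.tJoin (.var 1) (.var 3))
      (fun _ e₁ e₂ => by simp only [Fm.eval] at *; rw [e₁, e₂]) h₁ h₂
  · exact fun {a b c d} h₁ h₂ => biimp_mem_of_forall_four hD (assign a b c d) (.var 0) (.var 1)
      (.var 2) (.var 3) (.kMeet (.var 0) (.var 2)) (.kMeet (.var 1) (.var 3))
      (fun _ e₁ e₂ => by simp only [Fm.eval] at *; rw [e₁, e₂]) h₁ h₂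
  · exact fun {a b c d} h₁ h₂ => biimp_mem_of_forall_four hD (assign a b c d) (.var 0) (.var 1)
      (.var 2) (.var 3) (.kJoin (.var 0) (.var 2)) (.kJoin (.var 1) (.var 3))
      (fun _ e₁ e₂ => by simp only [Fm.eval] at *; rw [e₁, e₂]) h₁ h₂
  · exact fun {a b} h => biimp_mem_of_forall_four hD (assign a b a b) (.var 0) (.var 1)
      (.var 2) (.var 3) (.neg (.var 0)) (.neg (.var 1))
      (fun _ e _ => by simp only [Fm.eval] at *; rw [e]) h h
  · exact fun {a b c d} h₁ h₂ => biimp_mem_of_forall_four hD (assign a b c d) (.var 0) (.var 1)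
      (.var 2) (.var 3) (.imp (.var 0) (.var 2)) (.imp (.var 1) (.var 3))
      (fun _ e₁ e₂ => by simp only [Fm.eval] at *; rw [e₁, e₂]) h₁ h₂
  · intro a b ha hab
    refine mem_of_forall_four hD (assign a b b b) {.var 0, biimp (.var 0) (.var 1)} (.var 1)
      (fun r hr => ?_) ?_
    · have e₁ := hr (.var 0) (by simp)
      have e₂ := hr (biimp (.var 0) (.var 1)) (by simp)
      rw [(Fm.isHom_eval r).map_biimp, Four.des_biimp] at e₂
      rwa [e₂] at e₁
    · rintro γ (rfl | rfl)
      · exact ha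
      · exact hab

/-- The algebras of reduced models of `LB⊃` satisfy the identities of `FOUR⊃`. -/
theorem eval_eq_of_isReduced {A : Type u} [ImpSig A] {D : Set A} (hD : IsModel LBimp.{v} D)
    (hred : IsReduced D) (s : ℕ → A) (p q : Fm) (H : ∀ r : ℕ → Four.{v}, p.eval r = q.eval r) :
    p.eval s = q.eval s :=
  hred.2 (biimpSetoid_mem_matrixCongruences hD) (biimp_mem_of_identity hD s p q H)

theorem isImplicativeBilattice_of_isReduced {A : Type u} [ImpSig A] {D : Set A}
    (hD : IsModel LBimp.{v} D) (hred : IsReduced D) : IsImplicativeBilattice A := by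
  have hF := Four.isImplicativeBilattice.{v}
  have ht := hF.bilattice.tLattice
  have hk := hF.bilattice.kLattice
  have key := fun (a b c : A) => eval_eq_of_isReduced hD hred (assign a b c c)
  let x : Fm := .var 0
  let y : Fm := .var 1
  let z : Fm := .var 2
  refine ⟨⟨⟨?_, ?_, ?_, ?_, ?_, ?_⟩, ⟨?_, ?_, ?_, ?_, ?_, ?_⟩, ?_, ?_, ?_⟩,
    ?_, ?_, ?_, ?_, ?_, ?_, ?_, ?_⟩
  · exact fun a b => key a b b (x ⊓ₜ y) (y ⊓ₜ x) fun r => ht.meet_comm _ _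
  · exact fun a b => key a b b (x ⊔ₜ y) (y ⊔ₜ x) fun r => ht.join_comm _ _
  · exact fun a b c => key a b c (x ⊓ₜ y ⊓ₜ z) (x ⊓ₜ (y ⊓ₜ z)) fun r => ht.meet_assoc _ _ _
  · exact fun a b c => key a b c (x ⊔ₜ y ⊔ₜ z) (x ⊔ₜ (y ⊔ₜ z)) fun r => ht.join_assoc _ _ _
  · exact fun a b => key a b b (x ⊓ₜ (x ⊔ₜ y)) x fun r => ht.meet_join_self _ _
  · exact fun a b => key a b b (x ⊔ₜ (x ⊓ₜ y)) x fun r => ht.join_meet_self _ _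
  · exact fun a b => key a b b (x ⊓ₖ y) (y ⊓ₖ x) fun r => hk.meet_comm _ _
  · exact fun a b => key a b b (x ⊔ₖ y) (y ⊔ₖ x) fun r => hk.join_comm _ _
  · exact fun a b c => key a b c (x ⊓ₖ y ⊓ₖ z) (x ⊓ₖ (y ⊓ₖ z)) fun r => hk.meet_assoc _ _ _
  · exact fun a b c => key a b c (x ⊔ₖ y ⊔ₖ z) (x ⊔ₖ (y ⊔ₖ z)) fun r => hk.join_assoc _ _ _
  · exact fun a b => key a b b (x ⊓ₖ (x ⊔ₖ y)) x fun r => hk.meet_join_self _ _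
  · exact fun a b => key a b b (x ⊔ₖ (x ⊓ₖ y)) x fun r => hk.join_meet_self _ _
  -- Monotonicity laws are not identities; they are transferred in equational form with `a ⊓ₜ b` (or
  -- `a ⊓ₖ b`) in place of `a`.
  · intro a b e
    have := key a b b (∼ₙy ⊓ₜ ∼ₙ(x ⊓ₜ y)) (∼ₙy) fun r =>
      hF.bilattice.neg_tLe _ _ (ht.meet_le_right (r 0) (r 1))
    change ∼ₙb ⊓ₜ ∼ₙ(a ⊓ₜ b) = ∼ₙb at this
    rwa [show a ⊓ₜ b = a from e] at this
  · intro a b e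
    have := key a b b (∼ₙ(x ⊓ₖ y) ⊓ₖ ∼ₙy) (∼ₙ(x ⊓ₖ y)) fun r =>
      hF.bilattice.neg_kLe _ _ (hk.meet_le_right (r 0) (r 1))
    change ∼ₙ(a ⊓ₖ b) ⊓ₖ ∼ₙb = ∼ₙ(a ⊓ₖ b) at this
    rwa [show a ⊓ₖ b = a from e] at this
  · exact fun a => key a a a (∼ₙ(∼ₙx)) x fun r => hF.bilattice.neg_neg _
  · exact fun a b => key a b b ((x ⊃ᵢ x) ⊃ᵢ y) y fun r => hF.ib1 _ _
  · exact fun a b c => key a b c (x ⊃ᵢ (y ⊃ᵢ z)) ((x ⊓ₜ y) ⊃ᵢ z) fun r => hF.ib2_t _ _ _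
  · exact fun a b c => key a b c ((x ⊓ₜ y) ⊃ᵢ z) ((x ⊓ₖ y) ⊃ᵢ z) fun r => hF.ib2_k _ _ _
  · exact fun a b => key a b b (((x ⊃ᵢ y) ⊃ᵢ x) ⊃ᵢ x) (x ⊃ᵢ x) fun r => hF.ib3 _ _
  · exact fun a b c => key a b c ((x ⊔ₜ y) ⊃ᵢ z) ((x ⊃ᵢ z) ⊓ₜ (y ⊃ᵢ z)) fun r => hF.ib4_t _ _ _
  · exact fun a b c => key a b c ((x ⊃ᵢ z) ⊓ₜ (y ⊃ᵢ z)) ((x ⊔ₖ y) ⊃ᵢ z) fun r => hF.ib4_k _ _ _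
  · exact fun a b => key a b b (x ⊓ₜ ((x ⊃ᵢ y) ⊃ᵢ (x ⊓ₖ y))) x fun r => hF.ib5 _ _
  · exact fun a b c => key a b c (∼ₙ(x ⊃ᵢ y) ⊃ᵢ z) ((x ⊓ₜ ∼ₙy) ⊃ᵢ z) fun r => hF.ib6 _ _ _

theorem algStar_LBimp : AlgStar.{u} LBimp.{v} = ImpBiLat.{u} :=
  Set.Subset.antisymm (fun _ ⟨_, hD, hred⟩ => isImplicativeBilattice_of_isReduced hD hred)
    fun A hA => IsImplicativeBilattice.mem_algStar A hA

end Bilat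

theorem theoremt :
    -- the variety of implicative bilattices is generated by its four-element member `FOUR⊃`
    (Bilat.FOURimp.{u} ∈ Bilat.ImpBiLat.{u} ∧ Nat.card Bilat.FOURimp.{u} = 4 ∧
      Bilat.varietyGen.{u} {Bilat.FOURimp.{u}} = Bilat.ImpBiLat.{u}) ∧
    -- `FOUR⊃` is, up to isomorphism, its only non-trivial subdirectly irreducible member
    (∀ A : Bilat.ImpAlg.{u}, A ∈ Bilat.ImpBiLat.{u} → Nontrivial A →
      (Bilat.SubdirectlyIrreducible A ↔ Bilat.Isomorphic A Bilat.FOURimp.{u})) ∧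
    -- `Alg* LB⊃ = V(FOUR⊃)`
    Bilat.AlgStar.{u} Bilat.LBimp.{v} = Bilat.varietyGen.{u} {Bilat.FOURimp.{u}} := by
  refine ⟨⟨Bilat.Four.isImplicativeBilattice, Bilat.Four.card, Bilat.varietyGen_FOURimp⟩, ?_, ?_⟩
  · intro A hA _
    exact Bilat.subdirectlyIrreducible_iff A hA
  · rw [Bilat.algStar_LBimp, Bilat.varietyGen_FOURimp]
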